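/- Let $\mathcal{A}$ be an abelian category with enough projectives and enough injectives, and write $\mathrm{Proj}(\mathcal{A})$, $\mathrm{Inj}(\mathcal{A})$ for its classes of projective and injective objects. For classes of objects $\mathcal{U},\mathcal{V}\subseteq\mathcal{A}$ write $\mathcal{U}\perp\mathcal{V}$ if $\mathrm{Ext}^i_{\mathcal{A}}(U,V)=0$ for all $U\in\mathcal{U}$, $V\in\mathcal{V}$ and $i>0$. Let $(\mathcal{X},\mathcal{Y})$ be a GP-admissible pair of classes of objects of $\mathcal{A}$ with $\mathcal{X}\cap\mathcal{Y}=\mathrm{Proj}(\mathcal{A})$. Here GP-admissible means: every object of $\mathcal{A}$ is a quotient of an object of $\mathcal{X}$; $\mathcal{X}$ and $\mathcal{Y}$ are closed under finite coproducts and $\mathcal{X}$ is closed under extensions; for every $X\in\mathcal{X}$ there is a short exact sequence $0\to X\to W\to X'\to 0$ with $W\in\mathcal{X}\cap\mathcal{Y}$ and $X'\in\mathcal{X}$; and $\mathcal{X}\perp\mathcal{Y}$. Let $\mathcal{GP}_{(\mathcal{X},\mathcal{Y})}$ be the class of all objects isomorphic to a cycle of an exact complex $X_\bullet$ (indexed by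 $\mathbb{Z}$) with all $X_m\in\mathcal{X}$ and such that $\mathrm{Hom}_{\mathcal{A}}(X_\bullet,Y)$ is exact for all $Y\in\mathcal{Y}$. For an object $M$ let $\mathrm{Gpd}_{(\mathcal{X},\mathcal{Y})}(M)\in\mathbb{N}\cup\{\infty\}$ be the least $m\geq 0$ for which there is an exact sequence $0\to G_m\to\cdots\to G_0\to M\to 0$ with all $G_i\in\mathcal{GP}_{(\mathcal{X},\mathcal{Y})}$ ($\infty$ if there is none), and let $\mathrm{gl.GPD}_{(\mathcal{X},\mathcal{Y})}(\mathcal{A})=\sup_{M\in\mathcal{A}}\mathrm{Gpd}_{(\mathcal{X},\mathcal{Y})}(M)$. Let $\mathrm{Inj}(\mathcal{A})^{\vee}_n$ be the class of all objects $M$ for which there is an exact sequence $0\to M\to I_0\to\cdots\to I_m\to 0$ with $m\leq n$ and all $I_i$ injective. A pair $(\mathcal{U},\mathcal{V})$ of classes of objects is a cotorsion pair if $\mathcal{V}$ is the class of all $V$ with $\mathrm{Ext}^1_{\mathcal{A}}(U,V)=0$ for all $U\in\mathcal{U}$, and $\mathcal{U}$ is the class of all $U$ with $\mathrm{Ext}^1_{\mathcal{A}}(U,V)=0$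 for all $V\in\mathcal{V}$. It is complete if for every $A\in\mathcal{A}$ there are short exact sequences $0\to V\to U\to A\to 0$ and $0\to A\to V'\to U'\to 0$ with $U,U'\in\mathcal{U}$ and $V,V'\in\mathcal{V}$, and hereditary if $\mathcal{U}\perp\mathcal{V}$. Then, for every integer $n\geq 0$, $$\mathrm{gl.GPD}_{(\mathcal{X},\mathcal{Y})}(\mathcal{A})\leq n$$ if and only if $(\mathcal{GP}_{(\mathcal{X},\mathcal{Y})},\mathrm{Inj}(\mathcal{A})^{\vee}_n)$ is a hereditary complete cotorsion pair in $\mathcal{A}$. -/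

import Mathlib

open CategoryTheory Limits Abelian

universe w v u

namespace RelGorenstein

variable {C : Type u} [Category.{v} C] [Abelian C]

section Dimensions

/-- There is an exact sequence `0 → X_m → ⋯ → X_1 → X_0 → M → 0` with all `X_i` in `P`.
The exact sequence `S` has the objects `X_m, …, X_0, M` (up to isomorphism for the last one), and
the zeros at its ends are expressed by the first map being mono and the last one being epi. -/
def HasResolution (P : ObjectProperty C) (M : C) (m : ℕ) : Prop :=
  ∃ S : ComposableArrows C (m + 1),
    S.Exact ∧ Mono (S.map' 0 1) ∧ Epi (S.map' m (m + 1)) ∧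
      (∀ i : Fin (m + 1), P (S.obj i.castSucc)) ∧ Nonempty (S.obj (Fin.last (m + 1)) ≅ M)

/-- There is an exact sequence `0 → M → X_0 → X_1 → ⋯ → X_m → 0` with all `X_i` in `P`. -/
def HasCoresolution (P : ObjectProperty C) (M : C) (m : ℕ) : Prop :=
  ∃ S : ComposableArrows C (m + 1),
    S.Exact ∧ Mono (S.map' 0 1) ∧ Epi (S.map' m (m + 1)) ∧
      Nonempty (M ≅ S.obj 0) ∧ (∀ i : Fin (m + 1), P (S.obj i.succ))

/-- The `P`-resolution dimension of `M`: the least `m` such that `M` has a `P`-resolution of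
length `m`, and `⊤` if there is none. -/
noncomputable def resdim (P : ObjectProperty C) (M : C) : ℕ∞ :=
  ⨅ (m : ℕ) (_ : HasResolution P M m), (m : ℕ∞)

/-- The `P`-coresolution dimension of `M`. -/
noncomputable def coresdim (P : ObjectProperty C) (M : C) : ℕ∞ :=
  ⨅ (m : ℕ) (_ : HasCoresolution P M m), (m : ℕ∞)

/-- The class `P^∨_n` of the objects of `P`-coresolution dimension at most `n`. -/
def coresdimLE (P : ObjectProperty C) (n : ℕ) : ObjectProperty C :=
  fun M ↦ coresdim P M ≤ n

end Dimensions

section Gorenstein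

/-- The complex of abelian groups `Hom(K, Y)` is exact: every morphism `K.X i ⟶ Y` that
vanishes on the incoming differential factors through the outgoing one. -/
def HomExact (K : CochainComplex C ℤ) (Y : C) : Prop :=
  ∀ (i : ℤ) (f : K.X i ⟶ Y), K.d (i - 1) i ≫ f = 0 →
    ∃ g : K.X (i + 1) ⟶ Y, K.d i (i + 1) ≫ g = f

/-- The class of `(X, Y)`-Gorenstein projective objects: the cycles of the exact complexes of
objects of `X` that remain exact under `Hom(-, B)` for all `B` in `Y`. -/
def GP (X Y : ObjectProperty C) : ObjectProperty C :=
  fun M ↦ ∃ K : CochainComplex C ℤ,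
    K.Acyclic ∧ (∀ i, X (K.X i)) ∧ (∀ B, Y B → HomExact K B) ∧
      ∃ i : ℤ, Nonempty (K.cycles i ≅ M)

/-- The `(X, Y)`-Gorenstein projective dimension of an object. -/
noncomputable def Gpd (X Y : ObjectProperty C) (M : C) : ℕ∞ := resdim (GP X Y) M

variable (C) in
/-- The global `(X, Y)`-Gorenstein projective dimension of the category. -/
noncomputable def glGPD (X Y : ObjectProperty C) : ℕ∞ := ⨆ M : C, Gpd X Y M

end Gorenstein

section Ext

variable [HasExt.{w} C]

/-- `Ext^i(A, B) = 0` for all `A` in `X`, all `B` in `Y` and all `i > 0`. -/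
def Orthogonal (X Y : ObjectProperty C) : Prop :=
  ∀ ⦃A B : C⦄, X A → Y B → ∀ i : ℕ, 0 < i → Subsingleton (Ext.{w} A B i)

/-- The class of the objects `B` such that `Ext^1(A, B) = 0` for all `A` in `X`. -/
def rightOrthogonalOne (X : ObjectProperty C) : ObjectProperty C :=
  fun B ↦ ∀ A, X A → Subsingleton (Ext.{w} A B 1)

/-- The class of the objects `A` such that `Ext^1(A, B) = 0` for all `B` in `Y`. -/
def leftOrthogonalOne (Y : ObjectProperty C) : ObjectProperty C :=
  fun A ↦ ∀ B, Y B → Subsingleton (Ext.{w} A B 1)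

/-- A class of objects is closed under finite coproducts (including the empty one). -/
def ClosedUnderFiniteCoproducts (X : ObjectProperty C) : Prop :=
  ∀ (J : Type) [Finite J], X.IsClosedUnderColimitsOfShape (Discrete J)

/-- GP-admissible pairs of classes of objects. -/
structure GPAdmissible (X Y : ObjectProperty C) : Prop where
  /-- every object is a quotient of an object of `X` -/
  generator : ∀ A : C, ∃ (B : C) (p : B ⟶ A), X B ∧ Epi p
  coproducts_left : ClosedUnderFiniteCoproducts X
  coproducts_right : ClosedUnderFiniteCoproducts Y
  extensions : X.IsClosedUnderExtensions
  /-- every object `A` of `X` has a short exact sequence `0 → A → W → A' → 0` with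
  `W ∈ X ∩ Y` and `A' ∈ X` -/
  cogenerator : ∀ A : C, X A → ∃ S : ShortComplex C, S.ShortExact ∧
    Nonempty (S.X₁ ≅ A) ∧ (X ⊓ Y) S.X₂ ∧ X S.X₃
  orthogonal : Orthogonal.{w} X Y

/-- Cotorsion pairs of classes of objects. -/
structure IsCotorsionPair (X Y : ObjectProperty C) : Prop where
  right_eq : rightOrthogonalOne.{w} X = Y
  left_eq : X = leftOrthogonalOne.{w} Y

/-- Completeness of a (cotorsion) pair: all objects `A` have short exact sequences
`0 → Y → X → A → 0` and `0 → A → Y' → X' → 0` with `X, X'` and `Y, Y'` in the two classes. -/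
structure IsCompletePair (X Y : ObjectProperty C) : Prop where
  left_approx : ∀ A : C, ∃ S : ShortComplex C, S.ShortExact ∧
    Y S.X₁ ∧ X S.X₂ ∧ Nonempty (S.X₃ ≅ A)
  right_approx : ∀ A : C, ∃ S : ShortComplex C, S.ShortExact ∧
    Nonempty (S.X₁ ≅ A) ∧ Y S.X₂ ∧ X S.X₃

/-- Hereditary complete cotorsion pairs. -/
structure IsHereditaryCompleteCotorsionPair (X Y : ObjectProperty C) : Prop where
  cotorsion : IsCotorsionPair.{w} X Y
  complete : IsCompletePair X Y
  hereditary : Orthogonal.{w} X Y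

end Ext

end RelGorenstein

/-! Everything rests on an intrinsic description of `GP X Y`: it is the largest class left
orthogonal to `Y` in which every object embeds in a projective with cokernel again in the class
(`IsProjectivelyCoresolved.le_GP`, `isProjectivelyCoresolved_GP`). This makes `GP X Y` closed under
extensions, and dimension shifting along the embeddings kills its positive Ext into every object of
finite injective dimension.

Suppose the global dimension is at most `n`. Since projectives lie in `Y`, a `GP`-resolution of
length at most `n` of an arbitrary object shows that projectives have injective dimension at most
`n`. Induction along such a resolution then yields both approximation sequences, in the style of
Auslander and Buchweitz (`exists_approximations`). This is completeness; heredity is the Ext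
vanishing above. If an object is orthogonal to one of the two classes, the corresponding
approximation splits and exhibits it as a summand of an object of the other class, which gives both
orthogonality equalities.

Conversely, in any object the `n`-th syzygy has no Ext^1 into objects of injective dimension at most
`n`, so the cotorsion pair forces it into `GP X Y`, while the projective terms of the resolution are
in `GP X Y` anyway. -/

namespace RelGorenstein

variable {C : Type u} [Category.{v} C] [Abelian C]

/-! ### Short exact sequences, pushouts and vanishing of Ext -/

section ShortExactSequences

/-- There is a short exact sequence `0 → A → B → D → 0`. -/
def HasShortExact (A B D : C) : Prop :=
  ∃ (f : A ⟶ B) (g : B ⟶ D) (zero : f ≫ g = 0), (ShortComplex.mk f g zero).ShortExact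

lemma HasShortExact.of_shortExact {S : ShortComplex C} (hS : S.ShortExact) :
    HasShortExact S.X₁ S.X₂ S.X₃ :=
  ⟨S.f, S.g, S.zero, hS⟩

lemma HasShortExact.of_iso {A B D A' B' D' : C} (h : HasShortExact A B D)
    (e₁ : A ≅ A') (e₂ : B ≅ B') (e₃ : D ≅ D') : HasShortExact A' B' D' := by
  obtain ⟨f, g, zero, h⟩ := h
  refine ⟨e₁.inv ≫ f ≫ e₂.hom, e₂.inv ≫ g ≫ e₃.hom, by simp [reassoc_of% zero], ?_⟩
  exact ShortComplex.shortExact_of_iso (ShortComplex.isoMk e₁ e₂ e₃ (by simp) (by simp)) h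

lemma hasShortExact_id_left (A : C) {Z : C} (hZ : IsZero Z) :
    HasShortExact A A Z :=
  ⟨𝟙 A, 0, by simp,
    { exact := (ShortComplex.exact_iff_epi _ rfl).2 (by dsimp; infer_instance)
      mono_f := by dsimp; infer_instance
      epi_g := by dsimp; exact hZ.epi _ }⟩

lemma hasShortExact_id_right (A : C) {Z : C} (hZ : IsZero Z) :
    HasShortExact Z A A :=
  ⟨0, 𝟙 A, by simp,
    { exact := (ShortComplex.exact_iff_mono _ rfl).2 (by dsimp; infer_instance)
      mono_f := by dsimp; exact hZ.mono _
      epi_g := by dsimp; infer_instance }⟩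

lemma exists_hasShortExact_projective [EnoughProjectives C] (A : C) :
    ∃ K P : C, Projective P ∧ HasShortExact K P A :=
  ⟨_, Projective.over A, inferInstance, kernel.ι (Projective.π A), Projective.π A,
    kernel.condition _, { exact := ShortComplex.exact_kernel _ }⟩

lemma exists_hasShortExact_injective [EnoughInjectives C] (A : C) :
    ∃ I D : C, Injective I ∧ HasShortExact A I D :=
  ⟨Injective.under A, _, inferInstance, Injective.ι A, cokernel.π (Injective.ι A),
    cokernel.condition _, { exact := ShortComplex.exact_cokernel _ }⟩

lemma shortExact_pushout {A B D E : C} {f : A ⟶ B} {g : B ⟶ D} {zero : f ≫ g = 0}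
    (h : (ShortComplex.mk f g zero).ShortExact) (k : A ⟶ E) :
    (ShortComplex.mk (pushout.inr f k) (pushout.desc g 0 (by simp [zero]))
      (pushout.inr_desc _ _ _)).ShortExact := by
  have := h.mono_f
  have := h.epi_g
  dsimp at *
  have : Epi (pushout.desc g 0 (by simp [zero]) : pushout f k ⟶ D) :=
    epi_of_epi_fac (pushout.inl_desc _ _ _)
  refine { exact := ShortComplex.exact_of_g_is_cokernel _
            (CokernelCofork.IsColimit.ofπ' _ _ fun {T} t ht ↦ ?_) }
  have w : f ≫ pushout.inl f k ≫ t = 0 := by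
    rw [pushout.condition_assoc, ht, comp_zero]
  refine ⟨h.exact.desc (pushout.inl f k ≫ t) w, ?_⟩
  apply pushout.hom_ext
  · rw [pushout.inl_desc_assoc]
    exact h.exact.g_desc _ _
  · rw [pushout.inr_desc_assoc, zero_comp, ht]

/-- The pushout of two monomorphisms with the same source. -/
lemma HasShortExact.pushout {A B D B' D' : C} (h : HasShortExact A B D)
    (h' : HasShortExact A B' D') :
    ∃ N, HasShortExact B N D' ∧ HasShortExact B' N D := by
  obtain ⟨f, g, w, h⟩ := h
  obtain ⟨f', g', w', h'⟩ := h'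
  exact ⟨Limits.pushout f f', HasShortExact.of_iso ⟨_, _, _, shortExact_pushout h' f⟩
    (Iso.refl _) (pushoutSymmetry _ _) (Iso.refl _), ⟨_, _, _, shortExact_pushout h f'⟩⟩

lemma shortExact_comp {A B D B' : C} {f : A ⟶ B} {g : B ⟶ D} {zero : f ≫ g = 0}
    (h : (ShortComplex.mk f g zero).ShortExact) (u : B ⟶ B') [Mono u] :
    (ShortComplex.mk (f ≫ u) (pushout.inr g u)
      (by rw [Category.assoc, ← pushout.condition, reassoc_of% zero, zero_comp])).ShortExact := by
  have := h.mono_f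
  have := h.epi_g
  dsimp at *
  refine { exact := ShortComplex.exact_of_g_is_cokernel _
            (CokernelCofork.IsColimit.ofπ' _ _ fun {T} t ht ↦ ?_)
           mono_f := by dsimp; infer_instance
           epi_g := by dsimp; infer_instance }
  have w : f ≫ u ≫ t = 0 := by simpa using ht
  exact ⟨pushout.desc (h.exact.desc (u ≫ t) w) t (h.exact.g_desc _ _), pushout.inr_desc _ _ _⟩

/-- The cokernels of the composition of two monomorphisms. -/
lemma HasShortExact.comp {A B D B' E : C} (h : HasShortExact A B D)
    (h' : HasShortExact B B' E) :
    ∃ N, HasShortExact A B' N ∧ HasShortExact D N E := by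
  obtain ⟨f, g, w, h⟩ := h
  obtain ⟨u, v, w', h'⟩ := h'
  have := h'.mono_f
  dsimp at this
  exact ⟨Limits.pushout g u, ⟨_, _, _, shortExact_comp h u⟩,
    HasShortExact.of_iso ⟨_, _, _, shortExact_pushout h' g⟩
      (Iso.refl _) (pushoutSymmetry _ _) (Iso.refl _)⟩

variable [HasExt.{w} C]

lemma exists_splitting {S : ShortComplex C} (hS : S.ShortExact)
    (h : Subsingleton (Ext.{w} S.X₃ S.X₁ 1)) : Nonempty S.Splitting := by
  obtain ⟨x, hx⟩ := Ext.covariant_sequence_exact₃ _ hS (Ext.mk₀ (𝟙 S.X₃)) (zero_add 1)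
    (Subsingleton.elim _ _)
  obtain ⟨s, rfl⟩ := Ext.homEquiv₀.symm.surjective x
  have hs : s ≫ S.g = 𝟙 _ := Ext.homEquiv₀.symm.injective (by simpa using hx)
  have := hS.mono_f
  exact ⟨ShortComplex.Splitting.ofExactOfSection S hS.exact s hs inferInstance⟩

/-- The sequence splits, and the splitting read backwards is again short exact. This lets the
quotient `D` serve as the subobject in a later pushout. -/
lemma HasShortExact.swap {A B D : C} (h : HasShortExact A B D)
    (hE : Subsingleton (Ext.{w} D A 1)) : HasShortExact D B A := by
  obtain ⟨f, g, w, h⟩ := h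
  obtain ⟨σ⟩ := exists_splitting h hE
  have zero := σ.s_r
  refine ⟨σ.s, σ.r, zero, ShortComplex.Splitting.shortExact
    { r := g, s := f, f_r := σ.s_g, s_g := σ.f_r, id := ?_ }⟩
  have := σ.id
  dsimp at this ⊢
  rw [add_comm, this]

namespace HasShortExact

variable {A B D : C} (h : HasShortExact A B D) (T : C) (n : ℕ)
include h

lemma subsingleton_ext_third (h₁ : Subsingleton (Ext.{w} A T n))
    (h₂ : Subsingleton (Ext.{w} B T (n + 1))) : Subsingleton (Ext.{w} D T (n + 1)) := by
  obtain ⟨f, g, w, h⟩ := h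
  refine subsingleton_of_forall_eq 0 fun x ↦ ?_
  obtain ⟨y, rfl⟩ := Ext.contravariant_sequence_exact₃ h T x (Subsingleton.elim _ _) (add_comm _ _)
  rw [Subsingleton.elim y 0, Ext.comp_zero]

lemma subsingleton_ext_second (h₁ : Subsingleton (Ext.{w} A T n))
    (h₃ : Subsingleton (Ext.{w} D T n)) : Subsingleton (Ext.{w} B T n) := by
  obtain ⟨f, g, w, h⟩ := h
  refine subsingleton_of_forall_eq 0 fun x ↦ ?_
  obtain ⟨y, rfl⟩ := Ext.contravariant_sequence_exact₂ h T x (Subsingleton.elim _ _)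
  rw [Subsingleton.elim y 0, Ext.comp_zero]

lemma subsingleton_ext_first (h₂ : Subsingleton (Ext.{w} B T n))
    (h₃ : Subsingleton (Ext.{w} D T (n + 1))) : Subsingleton (Ext.{w} A T n) := by
  obtain ⟨f, g, w, h⟩ := h
  refine subsingleton_of_forall_eq 0 fun x ↦ ?_
  obtain ⟨y, rfl⟩ := Ext.contravariant_sequence_exact₁ h T x (add_comm _ _) (Subsingleton.elim _ _)
  rw [Subsingleton.elim y 0, Ext.comp_zero]

end HasShortExact

lemma subsingleton_ext_one_of_extension {S : ShortComplex C} (hS : S.ShortExact) (T : C)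
    (h₂ : Subsingleton (Ext.{w} S.X₂ T 1)) (h : ∀ φ : S.X₁ ⟶ T, ∃ ψ, S.f ≫ ψ = φ) :
    Subsingleton (Ext.{w} S.X₃ T 1) := by
  refine subsingleton_of_forall_eq 0 fun x ↦ ?_
  obtain ⟨y, rfl⟩ := Ext.contravariant_sequence_exact₃ hS T x (Subsingleton.elim _ _) (add_zero 1)
  obtain ⟨φ, rfl⟩ := Ext.homEquiv₀.symm.surjective y
  obtain ⟨ψ, rfl⟩ := h φ
  simp [← Ext.mk₀_comp_mk₀]

lemma exists_extension {S : ShortComplex C} (hS : S.ShortExact) {T : C}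
    (h : Subsingleton (Ext.{w} S.X₃ T 1)) (φ : S.X₁ ⟶ T) : ∃ ψ, S.f ≫ ψ = φ := by
  obtain ⟨y, hy⟩ := Ext.contravariant_sequence_exact₁ hS T (Ext.mk₀ φ) (add_zero 1)
    (Subsingleton.elim _ _)
  obtain ⟨ψ, rfl⟩ := Ext.homEquiv₀.symm.surjective y
  exact ⟨ψ, Ext.homEquiv₀.symm.injective (by simpa using hy)⟩

lemma HasShortExact.projective {A B D : C} (h : HasShortExact A B D) (hA : Projective A)
    (hD : Projective D) : Projective B :=
  projective_iff_subsingleton_ext_one.{w}.2 fun T ↦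
    h.subsingleton_ext_second T 1 (Ext.subsingleton_of_projective A T 0)
      (Ext.subsingleton_of_projective D T 0)

end ShortExactSequences

/-! ### Splicing short exact sequences into acyclic complexes -/

section Splicing

open ZeroObject

/-- In an exact complex, the consecutive cycles fit into short exact sequences. -/
lemma shortExact_cycles {K : CochainComplex C ℤ} (hK : K.Acyclic) (i : ℤ) :
    ∃ zero, (ShortComplex.mk (K.iCycles i) (K.toCycles i (i + 1)) zero).ShortExact := by
  have zero : K.iCycles i ≫ K.toCycles i (i + 1) = 0 := by
    simp [← cancel_mono (K.iCycles (i + 1))]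
  have : Epi (K.toCycles i (i + 1)) := Preadditive.epi_of_isZero_cokernel' _
    (K.homologyIsCokernel i (i + 1) (by simp)) (hK (i + 1)).isZero_homology
  refine ⟨zero, ⟨ShortComplex.exact_of_f_is_kernel _
    (KernelFork.IsLimit.ofι' _ _ fun t ht ↦ ⟨K.liftCycles t (i + 1) (by simp) ?_,
      K.liftCycles_i _ _ _ _⟩)⟩⟩
  dsimp at ht
  rw [← K.toCycles_i, reassoc_of% ht, zero_comp]

/-- Short exact sequences `0 → Z i → K i → Z (i + 1) → 0` can be spliced to a complex. -/
lemma exists_splice {Z K : ℤ → C} (h : ∀ i, HasShortExact (Z i) (K i) (Z (i + 1))) :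
    ∃ (L : CochainComplex C ℤ) (f : ∀ i, Z i ⟶ L.X i) (g : ∀ i, L.X i ⟶ Z (i + 1))
      (zero : ∀ i, f i ≫ g i = 0), (∀ i, L.X i = K i) ∧
      (∀ i, (ShortComplex.mk (f i) (g i) (zero i)).ShortExact) ∧
      ∀ i, L.d i (i + 1) = g i ≫ f (i + 1) := by
  choose f g zero h using h
  exact ⟨CochainComplex.of K (fun i ↦ g i ≫ f (i + 1)) fun i ↦ by simp [reassoc_of% (zero (i + 1))],
    f, g, zero, fun _ ↦ rfl, h, fun i ↦ CochainComplex.of_d K (fun i ↦ g i ≫ f (i + 1)) i⟩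

section

variable {Z : ℤ → C} {L : CochainComplex C ℤ} {f : ∀ i, Z i ⟶ L.X i}
  {g : ∀ i, L.X i ⟶ Z (i + 1)} {zero : ∀ i, f i ≫ g i = 0}
  (h : ∀ i, (ShortComplex.mk (f i) (g i) (zero i)).ShortExact)
  (hd : ∀ i, L.d i (i + 1) = g i ≫ f (i + 1))
include h hd

lemma exists_lift_of_comp_d_eq_zero {i : ℤ} {T : C} (t : T ⟶ L.X i)
    (ht : t ≫ L.d i (i + 1) = 0) : ∃ s, s ≫ f i = t := by
  have := (h i).mono_f
  have := (h (i + 1)).mono_f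
  dsimp at *
  have ht' : t ≫ g i = 0 := by
    rw [← cancel_mono (f (i + 1)), Category.assoc, ← hd, ht, zero_comp]
  exact ⟨(h i).exact.lift t ht', (h i).exact.lift_f t ht'⟩

lemma acyclic_of_shortExact : L.Acyclic := by
  intro j
  obtain ⟨i, rfl⟩ : ∃ i, j = i + 1 := ⟨j - 1, by simp⟩
  rw [HomologicalComplex.exactAt_iff' _ i (i + 1) (i + 1 + 1) (by simp) (by simp),
    ShortComplex.exact_iff_exact_up_to_refinements]
  intro T (t : T ⟶ L.X (i + 1)) (ht : t ≫ L.d (i + 1) (i + 1 + 1) = 0)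
  obtain ⟨s, hs⟩ := exists_lift_of_comp_d_eq_zero h hd t ht
  have := (h i).epi_g
  obtain ⟨T', π, hπ, x, hx⟩ := surjective_up_to_refinements_of_epi (g i) s
  refine ⟨T', π, hπ, x, ?_⟩
  change π ≫ t = x ≫ L.d i (i + 1)
  rw [hd, ← hs, reassoc_of% hx]

lemma nonempty_cycles_iso (i : ℤ) : Nonempty (L.cycles i ≅ Z i) := by
  have := (h i).mono_f
  dsimp at this
  have w : f i ≫ L.d i (i + 1) = 0 := by
    rw [hd, reassoc_of% (zero i), zero_comp]
  exact ⟨(L.cyclesIsKernel i (i + 1) (by simp)).conePointUniqueUpToIso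
    (KernelFork.IsLimit.ofι' (f i) w fun t ht ↦
      ⟨_, (exists_lift_of_comp_d_eq_zero h hd t ht).choose_spec⟩ :
      IsLimit (KernelFork.ofι (f i) w))⟩

/-- A cocycle on one term vanishes on its subobject of cycles because the preceding `g` is epi; it
therefore descends to the next `Z`, from where `hT` extends it to the next term. -/
lemma homExact_of_shortExact {T : C} (hT : ∀ i (φ : Z i ⟶ T), ∃ ψ, f i ≫ ψ = φ) :
    HomExact L T := by
  intro i φ hφ
  obtain ⟨j, rfl⟩ : ∃ j, i = j + 1 := ⟨i - 1, by simp⟩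
  rw [show j + 1 - 1 = j by simp, hd, Category.assoc] at hφ
  have := (h j).epi_g
  dsimp at this
  have := (h (j + 1)).epi_g
  have hφ' : f (j + 1) ≫ φ = 0 := by
    rw [← cancel_epi (g j), hφ, comp_zero]
  obtain ⟨ψ, hψ⟩ := hT (j + 1 + 1) ((h (j + 1)).exact.desc φ hφ')
  refine ⟨ψ, ?_⟩
  rw [hd, Category.assoc, hψ]
  exact (h (j + 1)).exact.g_desc φ hφ'

end

/-- A relation with predecessors and successors has bi-infinite chains through any point. -/
lemma exists_int_chain {α : Type*} (R : α → α → Prop) (hs : ∀ a, ∃ b, R a b)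
    (hp : ∀ b, ∃ a, R a b) (a : α) : ∃ z : ℤ → α, z 0 = a ∧ ∀ i, R (z i) (z (i + 1)) := by
  choose s hs using hs
  choose p hp using hp
  refine ⟨fun | .ofNat n => s^[n] a | .negSucc n => p^[n + 1] a, rfl, ?_⟩
  -- The three cases are `i ≥ 0`, the seam `i = -1`, and `i ≤ -2`.
  rintro (n | _ | n)
  · change R (s^[n] a) (s^[n + 1] a)
    rw [Function.iterate_succ_apply']
    exact hs _
  · exact hp _
  · change R (p^[n + 2] a) (p^[n + 1] a)
    rw [Function.iterate_succ_apply' p (n + 1)]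
    exact hp _

end Splicing

/-! ### Relative Gorenstein projective objects -/

section GorensteinProjective

open ZeroObject

variable {X Y : ObjectProperty C}

lemma GP.of_iso {A B : C} (h : GP X Y A) (e : A ≅ B) : GP X Y B := by
  obtain ⟨K, h₁, h₂, h₃, i, ⟨e'⟩⟩ := h
  exact ⟨K, h₁, h₂, h₃, i, ⟨e' ≪≫ e⟩⟩

lemma GP.exists_succ {A : C} (h : GP X Y A) :
    ∃ B D, X B ∧ GP X Y D ∧ HasShortExact A B D := by
  obtain ⟨K, h₁, h₂, h₃, i, ⟨e⟩⟩ := h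
  obtain ⟨zero, h⟩ := shortExact_cycles h₁ i
  exact ⟨_, _, h₂ i, ⟨K, h₁, h₂, h₃, i + 1, ⟨Iso.refl _⟩⟩,
    HasShortExact.of_iso ⟨_, _, _, h⟩ e (Iso.refl _) (Iso.refl _)⟩

lemma exists_extension_of_homExact {K : CochainComplex C ℤ} (hK : K.Acyclic) {T : C}
    (hT : HomExact K T) (i : ℤ) (φ : K.cycles i ⟶ T) : ∃ ψ, K.iCycles i ≫ ψ = φ := by
  obtain ⟨j, rfl⟩ : ∃ j, i = j + 1 := ⟨i - 1, by simp⟩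
  obtain ⟨_, h⟩ := shortExact_cycles hK j
  have := h.epi_g
  dsimp at this
  obtain ⟨ψ, hψ⟩ := hT j (K.toCycles j (j + 1) ≫ φ) (by simp)
  refine ⟨ψ, ?_⟩
  rw [← cancel_epi (K.toCycles j (j + 1)), K.toCycles_i_assoc, hψ]

variable [HasExt.{w} C]

variable (X Y) in
/-- All the groups `Ext^i(A, B)`, for `B` in `Y` and `i > 0`, are zero. -/
def leftOrthogonal : ObjectProperty C :=
  fun A ↦ ∀ B, Y B → ∀ i : ℕ, Subsingleton (Ext.{w} A B (i + 1))

lemma Orthogonal.leftOrthogonal (h : Orthogonal.{w} X Y) {A : C} (hA : X A) :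
    leftOrthogonal.{w} Y A :=
  fun _ hB _ ↦ h hA hB _ (Nat.succ_pos _)

lemma leftOrthogonal_of_projective (A : C) [Projective A] : leftOrthogonal.{w} Y A :=
  fun B _ i ↦ Ext.subsingleton_of_projective A B i

/-- Exactness under `Hom(-, B)` says that maps from cycles to `B` extend to the terms of the
complex, which is Ext^1 vanishing for the next cycle. Higher degrees follow by shifting along the
complex, whose terms are orthogonal to `B`. -/
lemma GP.leftOrthogonal (hXY : Orthogonal.{w} X Y) {A : C} (hA : GP X Y A) :
    leftOrthogonal.{w} Y A := by
  intro B hB n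
  induction n generalizing A with
  | zero =>
    obtain ⟨K, h₁, h₂, h₃, i, ⟨e⟩⟩ := hA
    obtain ⟨j, rfl⟩ : ∃ j, i = j + 1 := ⟨i - 1, by simp⟩
    obtain ⟨_, h⟩ := shortExact_cycles h₁ j
    have := subsingleton_ext_one_of_extension h B (hXY (h₂ j) hB 1 one_pos)
      (exists_extension_of_homExact h₁ (h₃ B hB) j)
    exact ((hasShortExact_id_right A (isZero_zero C)).of_iso (Iso.refl _) (Iso.refl _) e.symm
      ).subsingleton_ext_second B 1 (Ext.subsingleton_of_projective 0 B 0) this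
  | succ n ih =>
    obtain ⟨K, h₁, h₂, h₃, i, ⟨e⟩⟩ := hA
    obtain ⟨j, rfl⟩ : ∃ j, i = j + 1 := ⟨i - 1, by simp⟩
    obtain ⟨_, h⟩ := shortExact_cycles h₁ j
    exact (HasShortExact.of_iso ⟨_, _, _, h⟩ (Iso.refl _) (Iso.refl _) e).subsingleton_ext_third
      B (n + 1) (ih ⟨K, h₁, h₂, h₃, j, ⟨Iso.refl _⟩⟩) (hXY (h₂ j) hB _ (Nat.succ_pos _))

/-- A class `Q` of objects that are left orthogonal to `Y` and have short exact sequences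
`0 → A → P → A' → 0` with `P` projective and `A'` in `Q`. -/
structure IsProjectivelyCoresolved (Y Q : ObjectProperty C) : Prop where
  orthogonal : ∀ A, Q A → leftOrthogonal.{w} Y A
  exists_succ : ∀ A, Q A → ∃ P A', Projective P ∧ Q A' ∧ HasShortExact A P A'

/-- Splice a coresolution by projectives inside `Q` with a projective resolution on the left.
Syzygies stay left orthogonal to `Y`, so every map from a cycle to an object of `Y` extends. -/
lemma IsProjectivelyCoresolved.le_GP [EnoughProjectives C] {Q : ObjectProperty C}
    (hQ : IsProjectivelyCoresolved.{w} Y Q) (hX : isProjective C ≤ X) : Q ≤ GP X Y := by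
  -- The union of all such classes is used because it is closed under steps in both directions: a
  -- syzygy `A` of an object of `Q` lies in the enlarged class `{A} ∪ Q`.
  let α := { A : C // ∃ Q, IsProjectivelyCoresolved.{w} Y Q ∧ Q A }
  have hα : ∀ a : α, leftOrthogonal.{w} Y a.1 := fun ⟨A, Q, hQ, hA⟩ ↦ hQ.orthogonal A hA
  let R : α → α → Prop := fun a b ↦ ∃ P, Projective P ∧ HasShortExact a.1 P b.1
  have hs : ∀ a, ∃ b, R a b := by
    rintro ⟨A, Q, hQ, hA⟩
    obtain ⟨P, A', hP, hA', h⟩ := hQ.exists_succ A hA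
    exact ⟨⟨A', Q, hQ, hA'⟩, P, hP, h⟩
  have hp : ∀ b, ∃ a, R a b := by
    rintro ⟨B, Q, hQ, hB⟩
    obtain ⟨A, P, hP, h⟩ := exists_hasShortExact_projective B
    refine ⟨⟨A, fun M ↦ M = A ∨ Q M, ⟨?_, ?_⟩, Or.inl rfl⟩, P, hP, h⟩
    · rintro M (rfl | hM) T hT n
      · exact h.subsingleton_ext_first T (n + 1) (Ext.subsingleton_of_projective P T n)
          (hQ.orthogonal B hB T hT (n + 1))
      · exact hQ.orthogonal M hM T hT n
    · rintro M (rfl | hM)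
      · exact ⟨P, B, hP, Or.inr hB, h⟩
      · obtain ⟨P, M', hP, hM', h⟩ := hQ.exists_succ M hM
        exact ⟨P, M', hP, Or.inr hM', h⟩
  intro A hA
  obtain ⟨z, hz₀, hz⟩ := exists_int_chain R hs hp ⟨A, Q, hQ, hA⟩
  choose P hP hz using hz
  obtain ⟨L, f, g, zero, hL, h, hd⟩ := exists_splice (Z := fun i ↦ (z i).1) hz
  obtain ⟨e⟩ := nonempty_cycles_iso h hd 0
  exact ⟨L, acyclic_of_shortExact h hd, fun i ↦ hL i ▸ hX _ (hP i),
    fun T hT ↦ homExact_of_shortExact h hd fun i φ ↦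
      exists_extension (h i) (hα (z (i + 1)) T hT 0) φ,
    0, ⟨e ≪≫ eqToIso (by rw [hz₀])⟩⟩

/-- `GP` objects only come with embeddings into objects of `X`, and the cogenerator condition
replaces these by projectives. The cokernel is then an extension of an object of `X` by one of `GP X
Y`, so the class must allow such extensions from the start. -/
lemma isProjectivelyCoresolved_extension (hXY : GPAdmissible.{w} X Y)
    (hproj : X ⊓ Y = isProjective C) :
    IsProjectivelyCoresolved.{w} Y
      fun M ↦ ∃ A B, GP X Y A ∧ X B ∧ HasShortExact A M B where
  orthogonal := by
    rintro M ⟨A, B, hA, hB, h⟩ T hT n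
    exact h.subsingleton_ext_second T (n + 1) (hA.leftOrthogonal hXY.orthogonal T hT n)
      (hXY.orthogonal.leftOrthogonal hB T hT n)
  exists_succ := by
    rintro M ⟨A, B, hA, hB, h⟩
    obtain ⟨E, A', hE, hA', h'⟩ := hA.exists_succ
    -- `N` is an extension of `B` by `E`, hence in `X`, and it contains `M` with cokernel `A'`.
    obtain ⟨N, hN₁, hN₂⟩ := h.pushout h'
    have hN : X N := by
      obtain ⟨f, g, w, hN₂⟩ := hN₂
      exact hXY.extensions.prop_X₂_of_shortExact hN₂ hE hB
    obtain ⟨S, hS, ⟨e⟩, hP, hX₃⟩ := hXY.cogenerator N hN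
    rw [hproj] at hP
    obtain ⟨M', h₁, h₂⟩ := hN₁.comp
      ((HasShortExact.of_shortExact hS).of_iso e (Iso.refl _) (Iso.refl _))
    exact ⟨_, M', hP, ⟨_, _, hA', hX₃, h₂⟩, h₁⟩

lemma isProjectivelyCoresolved_GP [EnoughProjectives C] (hXY : GPAdmissible.{w} X Y)
    (hproj : X ⊓ Y = isProjective C) : IsProjectivelyCoresolved.{w} Y (GP X Y) where
  orthogonal A hA := hA.leftOrthogonal hXY.orthogonal
  exists_succ A hA := by
    have h0 : X (0 : C) := (hproj.ge _ (inferInstance : Projective (0 : C))).1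
    obtain ⟨P, A', hP, hA', h⟩ := (isProjectivelyCoresolved_extension hXY hproj).exists_succ A
      ⟨A, 0, hA, h0, hasShortExact_id_left A (isZero_zero C)⟩
    exact ⟨P, A', hP, (isProjectivelyCoresolved_extension hXY hproj).le_GP
      (hproj.ge.trans inf_le_left) _ hA', h⟩

/-- A horseshoe argument by two pushouts: the extensions of `GP` objects themselves form a
projectively coresolved class. -/
lemma GP_of_hasShortExact [EnoughProjectives C] (hXY : GPAdmissible.{w} X Y)
    (hproj : X ⊓ Y = isProjective C) {A B D : C} (h : HasShortExact A B D)
    (hA : GP X Y A) (hD : GP X Y D) : GP X Y B := by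
  have hGP := isProjectivelyCoresolved_GP hXY hproj
  have : IsProjectivelyCoresolved.{w} Y fun B ↦ ∃ A D, GP X Y A ∧ GP X Y D ∧
      HasShortExact A B D :=
    { orthogonal := by
        rintro B ⟨A, D, hA, hD, h⟩ T hT n
        exact h.subsingleton_ext_second T (n + 1) (hGP.orthogonal A hA T hT n)
          (hGP.orthogonal D hD T hT n)
      exists_succ := by
        rintro B ⟨A, D, hA, hD, h⟩
        obtain ⟨P, A', hP, hA', h₁⟩ := hGP.exists_succ A hA
        obtain ⟨P', D', hP', hD', h₂⟩ := hGP.exists_succ D hD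
        obtain ⟨N, hN₁, hN₂⟩ := h.pushout h₁
        -- `P` is in `Y`, so the extension `N` of `D` by `P` splits and `D` becomes a subobject with
        -- quotient `P`. Embedding `D` in `P'` then makes `P''` an extension of projectives.
        obtain ⟨P'', hP₁, hP₂⟩ := (hN₂.swap
          (hGP.orthogonal D hD P (hproj.ge P hP).2 0)).pushout h₂
        obtain ⟨B', hB₁, hB₂⟩ := hN₁.comp hP₁
        exact ⟨P'', B', hP₂.projective hP' hP, ⟨A', D', hA', hD', hB₂⟩, hB₁⟩ }
  exact this.le_GP (hproj.ge.trans inf_le_left) _ ⟨A, D, hA, hD, h⟩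

lemma GP_of_projective [EnoughProjectives C] (hproj : X ⊓ Y = isProjective C)
    (P : C) [Projective P] : GP X Y P := by
  have : IsProjectivelyCoresolved.{w} Y (isProjective C) :=
    { orthogonal := fun A (_ : Projective A) ↦ leftOrthogonal_of_projective A
      exists_succ := fun A hA ↦ ⟨A, 0, hA, (inferInstance : Projective (0 : C)),
        hasShortExact_id_left A (isZero_zero C)⟩ }
  exact this.le_GP (hproj.ge.trans inf_le_left) _ (inferInstance : Projective P)

end GorensteinProjective

/-! ### Finite resolutions, coresolutions and dimension shifting -/

section ExactSequences

open ComposableArrows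

/-- The sequence `0 → S 0 → ⋯ → S (m + 1) → 0` is exact. -/
structure IsExactSequence {m : ℕ} (S : ComposableArrows C (m + 1)) : Prop where
  exact : S.Exact
  mono : Mono (S.map' 0 1)
  epi : Epi (S.map' m (m + 1))

lemma exact_epi_comp_iff {A B D E : C} (e : A ⟶ B) [Epi e] {f : B ⟶ D} {g : D ⟶ E}
    (zero : f ≫ g = 0) (zero' : (e ≫ f) ≫ g = 0) :
    (ShortComplex.mk (e ≫ f) g zero').Exact ↔ (ShortComplex.mk f g zero).Exact := by
  let φ : ShortComplex.mk (e ≫ f) g zero' ⟶ ShortComplex.mk f g zero :=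
    { τ₁ := e, τ₂ := 𝟙 _, τ₃ := 𝟙 _ }
  have : Epi φ.τ₁ := by dsimp [φ]; infer_instance
  have : IsIso φ.τ₂ := by dsimp [φ]; infer_instance
  have : Mono φ.τ₃ := by dsimp [φ]; infer_instance
  exact ShortComplex.exact_iff_of_epi_of_isIso_of_mono φ

lemma exact_comp_mono_iff {A B D E : C} {f : A ⟶ B} {g : B ⟶ D} (m : D ⟶ E) [Mono m]
    (zero : f ≫ g = 0) (zero' : f ≫ g ≫ m = 0) :
    (ShortComplex.mk f (g ≫ m) zero').Exact ↔ (ShortComplex.mk f g zero).Exact := by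
  let φ : ShortComplex.mk f g zero ⟶ ShortComplex.mk f (g ≫ m) zero' :=
    { τ₁ := 𝟙 _, τ₂ := 𝟙 _, τ₃ := m }
  have : Epi φ.τ₁ := by dsimp [φ]; infer_instance
  have : IsIso φ.τ₂ := by dsimp [φ]; infer_instance
  have : Mono φ.τ₃ := by dsimp [φ]; infer_instance
  exact (ShortComplex.exact_iff_of_epi_of_isIso_of_mono φ).symm

lemma hasShortExact_image {A B D : C} {f : A ⟶ B} {g : B ⟶ D} {zero : f ≫ g = 0}
    (h : (ShortComplex.mk f g zero).Exact) : HasShortExact (image f) B (image g) := by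
  have zero₁ : Limits.image.ι f ≫ g = 0 := by
    rw [← cancel_epi (factorThruImage f), Limits.image.fac_assoc, zero, comp_zero]
  have zero₂ : Limits.image.ι f ≫ factorThruImage g = 0 := by
    rw [← cancel_mono (Limits.image.ι g), Category.assoc, Limits.image.fac, zero₁, zero_comp]
  refine ⟨Limits.image.ι f, factorThruImage g, zero₂, ⟨?_⟩⟩
  rw [← exact_comp_mono_iff (Limits.image.ι g) zero₂ (by rwa [Limits.image.fac]),
    ← exact_epi_comp_iff (factorThruImage f) _ (by simpa using zero)]
  simpa only [Limits.image.fac] using h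

lemma nonempty_image_iso {A B : C} (f : A ⟶ B) [Epi f] : Nonempty (image f ≅ B) := by
  have : Epi (Limits.image.ι f) := epi_of_epi_fac (Limits.image.fac f)
  have := isIso_of_mono_of_epi (Limits.image.ι f)
  exact ⟨asIso (Limits.image.ι f)⟩

/-- The images of the maps of an exact sequence. -/
noncomputable abbrev imageObj {m : ℕ} (S : ComposableArrows C (m + 1)) (k : ℕ) (hk : k ≤ m) : C :=
  image (S.map' k (k + 1))

namespace IsExactSequence

variable {m : ℕ} {S : ComposableArrows C (m + 1)} (hS : IsExactSequence S)
include hS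

lemma hasShortExact_imageObj (k : ℕ) (hk : k + 1 ≤ m) :
    HasShortExact (imageObj S k (by lia)) (S.obj' (k + 1)) (imageObj S (k + 1) hk) :=
  hasShortExact_image (hS.exact.exact k)

lemma nonempty_iso_imageObj_zero : Nonempty (S.obj' 0 ≅ imageObj S 0 (Nat.zero_le _)) := by
  have : Mono (S.map' 0 (0 + 1)) := hS.mono
  exact ⟨(imageMonoIsoSource _).symm⟩

lemma nonempty_imageObj_last_iso : Nonempty (imageObj S m le_rfl ≅ S.obj' (m + 1)) := by
  have := hS.epi
  exact nonempty_image_iso _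

/-- A short exact sequence spliced to the left end of an exact sequence. -/
lemma exists_cons {A B : C} (h : HasShortExact A B (S.obj 0)) :
    ∃ S' : ComposableArrows C (m + 2), IsExactSequence S' ∧ S'.obj 0 = A ∧ S'.obj 1 = B ∧
      ∀ i : Fin (m + 1), S'.obj i.succ.succ = S.obj i.succ := by
  obtain ⟨F, D, s, rfl⟩ := precomp_surjective S
  obtain ⟨f, g, zero, h⟩ : HasShortExact A B D := h
  have := h.mono_f
  have := h.epi_g
  have : Mono s := hS.mono
  have := hS.epi
  dsimp only at *
  have zero' : f ≫ g ≫ s = 0 := by rw [reassoc_of% zero, zero_comp]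
  refine ⟨(F.precomp (g ≫ s)).precomp f, ⟨?_, ?_, ?_⟩, rfl, rfl, fun _ ↦ rfl⟩
  · refine exact_of_δ₀ (exact₂_mk _ zero' ?_) ?_
    · exact (exact_comp_mono_iff s zero zero').2 h.exact
    · change (F.precomp (g ≫ s)).Exact
      cases m with
      | zero => exact exact₁ _
      | succ m =>
        have zero₁ : s ≫ F.map' 0 1 = 0 := hS.exact.zero 0
        have zero₂ : (g ≫ s) ≫ F.map' 0 1 = 0 := by rw [Category.assoc, zero₁, comp_zero]
        have hs : (ShortComplex.mk s (F.map' 0 1) zero₁).Exact := hS.exact.exact 0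
        exact exact_of_δ₀ (exact₂_mk _ zero₂ ((exact_epi_comp_iff g zero₁ zero₂).2 hs))
          hS.exact.δ₀
  · exact (inferInstance : Mono f)
  · cases m with
    | zero =>
      have : Epi s := hS.epi
      exact (inferInstance : Epi (g ≫ s))
    | succ m => exact hS.epi

end IsExactSequence

lemma isExactSequence_mk₁ {A B : C} (e : A ≅ B) : IsExactSequence (mk₁ e.hom) :=
  ⟨exact₁ _, inferInstanceAs (Mono e.hom), inferInstanceAs (Epi e.hom)⟩

variable {P : ObjectProperty C}

/-- Dimension shifting along a resolution. -/
lemma HasResolution.induction [P.IsClosedUnderIsomorphisms] {M : C} {m : ℕ}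
    (h : HasResolution P M m) {R : ℕ → ObjectProperty C}
    [∀ k, (R k).IsClosedUnderIsomorphisms] (h₀ : P ≤ R 0)
    (hR : ∀ k A B D, HasShortExact A B D → R k A → P B → R (k + 1) D) : R m M := by
  obtain ⟨S, h₁, h₂, h₃, hP, ⟨e⟩⟩ := h
  have hS : IsExactSequence S := ⟨h₁, h₂, h₃⟩
  have (k : ℕ) (hk : k ≤ m) : R k (imageObj S k hk) := by
    induction k with
    | zero =>
      obtain ⟨e⟩ := hS.nonempty_iso_imageObj_zero
      exact (R 0).prop_of_iso e (h₀ _ (hP 0))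
    | succ k ih =>
      exact hR _ _ _ _ (hS.hasShortExact_imageObj k hk) (ih (by lia))
        (hP ⟨k + 1, by lia⟩)
  obtain ⟨e'⟩ := hS.nonempty_imageObj_last_iso
  exact (R m).prop_of_iso (e' ≪≫ e) (this m le_rfl)

/-- Dimension shifting along a coresolution. -/
lemma HasCoresolution.induction [P.IsClosedUnderIsomorphisms] {M : C} {m : ℕ}
    (h : HasCoresolution P M m) {R : ℕ → ObjectProperty C}
    [∀ k, (R k).IsClosedUnderIsomorphisms] (h₀ : P ≤ R 0)
    (hR : ∀ k A B D, HasShortExact A B D → P B → R k D → R (k + 1) A) : R m M := by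
  obtain ⟨S, h₁, h₂, h₃, ⟨e⟩, hP⟩ := h
  have hS : IsExactSequence S := ⟨h₁, h₂, h₃⟩
  have (j k : ℕ) (hk : k + j = m) : R j (imageObj S k (by lia)) := by
    induction j generalizing k with
    | zero =>
      obtain rfl : k = m := by simpa using hk
      obtain ⟨e⟩ := hS.nonempty_imageObj_last_iso
      exact (R 0).prop_of_iso e.symm (h₀ _ (hP (Fin.last _)))
    | succ j ih =>
      exact hR _ _ _ _ (hS.hasShortExact_imageObj k (by lia)) (hP ⟨k, by lia⟩)
        (ih (k + 1) (by lia))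
  obtain ⟨e'⟩ := hS.nonempty_iso_imageObj_zero
  exact (R m).prop_of_iso (e ≪≫ e').symm (this m 0 (by simp))

lemma hasCoresolution_zero {M : C} (hM : P M) : HasCoresolution P M 0 := by
  obtain ⟨h₁, h₂, h₃⟩ := isExactSequence_mk₁ (Iso.refl M)
  refine ⟨_, h₁, h₂, h₃, ⟨Iso.refl _⟩, fun i ↦ ?_⟩
  obtain rfl : i = 0 := Fin.fin_one_eq_zero i
  exact hM

lemma HasCoresolution.cons {A B D : C} {m : ℕ} (h : HasShortExact A B D) (hB : P B)
    (hD : HasCoresolution P D m) : HasCoresolution P A (m + 1) := by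
  obtain ⟨S, h₁, h₂, h₃, ⟨e⟩, hP⟩ := hD
  obtain ⟨S', ⟨h₁, h₂, h₃⟩, eA, eB, hS⟩ := IsExactSequence.exists_cons ⟨h₁, h₂, h₃⟩
    (h.of_iso (Iso.refl _) (Iso.refl _) e)
  refine ⟨S', h₁, h₂, h₃, ⟨eqToIso eA.symm⟩, fun i ↦ ?_⟩
  induction i using Fin.cases with
  | zero => exact eB ▸ hB
  | succ i => exact hS i ▸ hP i

/-- The construction of a resolution by taking successive syzygies. -/
lemma hasResolution_of_syzygies {R : ℕ → ObjectProperty C} (h₀ : R 0 ≤ P)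
    (hR : ∀ k D, R (k + 1) D → ∃ A B, R k A ∧ P B ∧ HasShortExact A B D) {m : ℕ} {M : C}
    (hM : R m M) : HasResolution P M m := by
  -- After `j` syzygies the leftmost object only satisfies `R k`; the other terms before `M` are
  -- already in `P`. At `k = 0` the leftmost one is in `P` too.
  suffices ∀ (j k : ℕ), j + k = m → ∃ S : ComposableArrows C (j + 1), IsExactSequence S ∧
      R k (S.obj 0) ∧ (∀ i : Fin j, P (S.obj i.succ.castSucc)) ∧
      Nonempty (S.obj (Fin.last (j + 1)) ≅ M) by
    obtain ⟨S, ⟨h₁, h₂, h₃⟩, hS₀, hS, hM⟩ := this m 0 rfl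
    refine ⟨S, h₁, h₂, h₃, fun i ↦ ?_, hM⟩
    induction i using Fin.cases with
    | zero => exact h₀ _ hS₀
    | succ i => exact hS i
  intro j
  induction j with
  | zero =>
    rintro k hk
    obtain rfl : k = m := by simpa using hk
    exact ⟨_, isExactSequence_mk₁ (Iso.refl M), hM, fun i ↦ i.elim0, ⟨Iso.refl _⟩⟩
  | succ j ih =>
    intro k hk
    obtain ⟨S, hS, hS₀, hP, ⟨e⟩⟩ := ih (k + 1) (by lia)
    obtain ⟨A, B, hA, hB, h⟩ := hR _ _ hS₀
    obtain ⟨S', hS', eA, eB, hS''⟩ := hS.exists_cons h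
    refine ⟨S', hS', eA ▸ hA, fun i ↦ ?_, ⟨eqToIso (hS'' (Fin.last j)) ≪≫ e⟩⟩
    induction i using Fin.cases with
    | zero => exact eB ▸ hB
    | succ i => exact (hS'' i.castSucc).symm ▸ hP i

lemma resdim_le_iff {M : C} {n : ℕ} :
    resdim P M ≤ n ↔ ∃ m ≤ n, HasResolution P M m := by
  refine ⟨fun h ↦ ?_, fun ⟨m, hm, h⟩ ↦ iInf₂_le_of_le m h (by exact_mod_cast hm)⟩
  by_contra! h'
  have : ((n + 1 : ℕ) : ℕ∞) ≤ resdim P M := le_iInf₂ fun m hm ↦ by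
    have : n + 1 ≤ m := by
      by_contra! hlt
      exact h' m (by lia) hm
    exact_mod_cast this
  have := this.trans h
  norm_cast at this
  lia

lemma coresdimLE_iff {M : C} {n : ℕ} :
    coresdimLE P n M ↔ ∃ m ≤ n, HasCoresolution P M m := by
  refine ⟨fun h ↦ ?_, fun ⟨m, hm, h⟩ ↦ iInf₂_le_of_le m h (by exact_mod_cast hm)⟩
  by_contra! h'
  have : ((n + 1 : ℕ) : ℕ∞) ≤ coresdim P M := le_iInf₂ fun m hm ↦ by
    have : n + 1 ≤ m := by
      by_contra! hlt
      exact h' m (by lia) hm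
    exact_mod_cast this
  have := this.trans h
  norm_cast at this
  lia

end ExactSequences

/-! ### Injective coresolutions and injective dimension -/

section InjectiveDimension

instance : (isInjective C).IsClosedUnderIsomorphisms :=
  ⟨fun e (h : Injective _) ↦ Injective.of_iso e h⟩

lemma coresdimLE_isInjective_iff [EnoughInjectives C] {M : C} {n : ℕ} :
    coresdimLE (isInjective C) n M ↔ HasInjectiveDimensionLE M n := by
  rw [coresdimLE_iff]
  constructor
  · rintro ⟨m, hm, h⟩
    let R (k : ℕ) : ObjectProperty C := fun M ↦ HasInjectiveDimensionLE M k
    have (k : ℕ) : (R k).IsClosedUnderIsomorphisms :=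
      ⟨fun e (h : HasInjectiveDimensionLE _ k) ↦ hasInjectiveDimensionLT_of_iso e (k + 1)⟩
    have : HasInjectiveDimensionLE M m :=
      h.induction (R := R)
        (fun A (hA : Injective A) ↦ (inferInstance : HasInjectiveDimensionLT A 1))
        (fun k A B D ⟨f, g, zero, h⟩ (hB : Injective B) hD ↦
          h.hasInjectiveDimensionLT_X₁ (k + 1) hD
            (hasInjectiveDimensionLT_of_ge B 1 (k + 2) (by lia)))
    exact hasInjectiveDimensionLT_of_ge M (m + 1) (n + 1) (by lia)
  · intro h
    refine ⟨n, le_rfl, ?_⟩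
    induction n generalizing M with
    | zero => exact hasCoresolution_zero (injective_iff_hasInjectiveDimensionLT_one.2 h)
    | succ n ih =>
      obtain ⟨I, D, hI, hs⟩ := exists_hasShortExact_injective M
      refine HasCoresolution.cons hs hI (ih ?_)
      obtain ⟨f, g, zero, hs⟩ := hs
      exact (hs.hasInjectiveDimensionLT_X₃_iff n hI).2 h

lemma coresdimLE_isInjective [EnoughInjectives C] (n : ℕ) :
    coresdimLE (isInjective C) n = fun M ↦ HasInjectiveDimensionLE M n := by
  ext M
  exact coresdimLE_isInjective_iff

end InjectiveDimension

/-! ### Approximations and the cotorsion pair -/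

section Cotorsion

open ZeroObject

variable {X Y : ObjectProperty C} {n : ℕ}

instance : (GP X Y).IsClosedUnderIsomorphisms := ⟨fun e h ↦ h.of_iso e⟩

lemma exists_hasResolution_of_glGPD_le (h : glGPD C X Y ≤ n) (M : C) :
    ∃ m ≤ n, HasResolution (GP X Y) M m :=
  resdim_le_iff.1 ((le_iSup _ M).trans h)

variable [HasExt.{w} C]

lemma IsProjectivelyCoresolved.subsingleton_ext {Q : ObjectProperty C}
    (hQ : IsProjectivelyCoresolved.{w} Y Q) {A B : C} (hA : Q A)
    (hB : HasInjectiveDimensionLE B n) (i : ℕ) : Subsingleton (Ext.{w} A B (i + 1)) := by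
  -- Each embedding in a projective raises the Ext degree by one; `k` bounds the steps needed until
  -- it exceeds `n`.
  suffices ∀ (k i : ℕ) (A : C), Q A → n ≤ i + k → Subsingleton (Ext.{w} A B (i + 1)) from
    this n i A hA (by lia)
  intro k
  induction k with
  | zero =>
    intro i A _ hi
    exact HasInjectiveDimensionLT.subsingleton B (n + 1) (i + 1) (by lia) A
  | succ k ih =>
    intro i A hA hi
    obtain ⟨P, A', hP, hA', h⟩ := hQ.exists_succ A hA
    exact h.subsingleton_ext_first B (i + 1) (Ext.subsingleton_of_projective P B i)
      (ih (i + 1) A' hA' (by lia))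

lemma hasInjectiveDimensionLE_of_projective [EnoughProjectives C] (hXY : GPAdmissible.{w} X Y)
    (hproj : X ⊓ Y = isProjective C) (h : glGPD C X Y ≤ n) (P : C) [hP : Projective P] :
    HasInjectiveDimensionLE P n := by
  refine hasInjectiveDimensionLT_of_enoughProjectives.{w} P (n + 1) fun M ↦ ?_
  obtain ⟨m, hm, hM⟩ := exists_hasResolution_of_glGPD_le h M
  -- All degrees above `k` are included since the resolution length `m` may be smaller than `n`.
  let R (k : ℕ) : ObjectProperty C := fun M ↦ ∀ i, k ≤ i → Subsingleton (Ext.{w} M P (i + 1))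
  have (k : ℕ) : (R k).IsClosedUnderIsomorphisms :=
    ⟨fun e h i hi ↦ ((hasShortExact_id_right _ (isZero_zero C)).of_iso (Iso.refl _) e
      (Iso.refl _)).subsingleton_ext_second P (i + 1) (Ext.subsingleton_of_projective 0 P i)
      (h i hi)⟩
  refine hM.induction (R := R)
    (fun A hA i _ ↦ hA.leftOrthogonal hXY.orthogonal P (hproj.ge P hP).2 i)
    (fun k A B D h hA hB i hi ↦ ?_) n hm
  obtain ⟨i, rfl⟩ : ∃ j, i = j + 1 := ⟨i - 1, by lia⟩
  exact h.subsingleton_ext_third P (i + 1) (hA i (by lia))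
    (hB.leftOrthogonal hXY.orthogonal P (hproj.ge P hP).2 (i + 1))

/-- Approximations of the objects of finite Gorenstein projective dimension. -/
lemma exists_approximations [EnoughProjectives C] (hXY : GPAdmissible.{w} X Y)
    (hproj : X ⊓ Y = isProjective C) (h : glGPD C X Y ≤ n) (M : C) :
    (∃ L G, HasInjectiveDimensionLE L n ∧ GP X Y G ∧ HasShortExact M L G) ∧
      ∃ L G, HasInjectiveDimensionLE L n ∧ GP X Y G ∧ HasShortExact L G M := by
  have hGP := isProjectivelyCoresolved_GP hXY hproj
  obtain ⟨m, hm, hM⟩ := exists_hasResolution_of_glGPD_le h M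
  let R : ObjectProperty C := fun M ↦
    (∃ L G, HasInjectiveDimensionLE L n ∧ GP X Y G ∧ HasShortExact M L G) ∧
      ∃ L G, HasInjectiveDimensionLE L n ∧ GP X Y G ∧ HasShortExact L G M
  have : R.IsClosedUnderIsomorphisms := by
    refine ⟨?_⟩
    rintro A B e ⟨⟨L, G, hL, hG, h⟩, L', G', hL', hG', h'⟩
    exact ⟨⟨L, G, hL, hG, h.of_iso e (Iso.refl _) (Iso.refl _)⟩,
      L', G', hL', hG', h'.of_iso (Iso.refl _) (Iso.refl _) e⟩
  have hP (P : C) (_ : Projective P) : HasInjectiveDimensionLE P n :=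
    hasInjectiveDimensionLE_of_projective hXY hproj h P
  refine hM.induction (R := fun _ ↦ R) ?_ ?_
  · intro A hA
    obtain ⟨P, A', hP', hA', h⟩ := hGP.exists_succ A hA
    exact ⟨⟨P, A', hP P hP', hA', h⟩, 0, A, hP 0 inferInstance, hA,
      hasShortExact_id_right A (isZero_zero C)⟩
  · rintro - A B D hs ⟨⟨L, G, hL, hG, h⟩, -⟩ hB
    -- The pushout `G'` is an extension of `G` by `B`, hence in `GP X Y`, and it maps onto `D` with
    -- kernel `L`.
    obtain ⟨G', h₁, h₂⟩ := hs.pushout h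
    have hG' := GP_of_hasShortExact hXY hproj h₁ hB hG
    obtain ⟨P, G'', hP', hG'', h₃⟩ := hGP.exists_succ G' hG'
    -- `L'` is the quotient of `P` by `L`, both of injective dimension at most `n`, so the bound
    -- does not grow along the induction.
    obtain ⟨L', ⟨f, g, zero, h₄⟩, h₅⟩ := h₂.comp h₃
    exact ⟨⟨L', G'', h₄.hasInjectiveDimensionLT_X₃ (n + 1) (hP P hP')
      (hasInjectiveDimensionLT_of_ge L (n + 1) (n + 2) (by lia)), hG'', h₅⟩, L, G', hL, hG', h₂⟩

lemma subsingleton_ext_of_section {A B : C} {s : A ⟶ B} {r : B ⟶ A} (hs : s ≫ r = 𝟙 A) (T : C)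
    (i : ℕ) (h : Subsingleton (Ext.{w} B T i)) : Subsingleton (Ext.{w} A T i) := by
  refine subsingleton_of_forall_eq 0 fun x ↦ ?_
  rw [← x.mk₀_id_comp, ← hs, ← Ext.mk₀_comp_mk₀, Ext.comp_assoc_of_second_deg_zero,
    Subsingleton.elim ((Ext.mk₀ r).comp x (zero_add i)) 0, Ext.comp_zero]

/-- The approximation of `A` splits, so `A` is a summand of some `G` in `GP X Y`. Closure of `GP X
Y` under summands is not needed: the left orthogonal class is itself projectively coresolved. -/
lemma leftOrthogonalOne_le_GP [EnoughProjectives C] (hXY : GPAdmissible.{w} X Y)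
    (hproj : X ⊓ Y = isProjective C) (h : glGPD C X Y ≤ n) :
    leftOrthogonalOne.{w} (fun M : C ↦ HasInjectiveDimensionLE M n) ≤ GP X Y := by
  have hGP := isProjectivelyCoresolved_GP hXY hproj
  refine IsProjectivelyCoresolved.le_GP.{w} ⟨fun A hA T hT i ↦ ?_, fun A hA ↦ ?_⟩
    (hproj.ge.trans inf_le_left)
  all_goals
    obtain ⟨-, L, G, hL, hG, f, g, zero, hs⟩ := exists_approximations hXY hproj h A
    obtain ⟨σ⟩ := exists_splitting hs (hA L hL)
    have hσ : σ.s ≫ g = 𝟙 A := σ.s_g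
  · exact subsingleton_ext_of_section hσ T _ (hGP.orthogonal G hG T hT i)
  · obtain ⟨P, G', hP, hG', u, v, zero', hs'⟩ := hGP.exists_succ G hG
    have := hs'.mono_f
    have hσ' : Mono σ.s := mono_of_mono_fac hσ
    dsimp at this hσ'
    have hS : (ShortComplex.mk _ _ (cokernel.condition (σ.s ≫ u))).ShortExact :=
      { exact := ShortComplex.exact_cokernel _ }
    refine ⟨P, cokernel (σ.s ≫ u), hP, fun B hB ↦ ?_, _, _, _, hS⟩
    refine subsingleton_ext_one_of_extension hS B (Ext.subsingleton_of_projective P B 0) ?_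
    intro (φ : A ⟶ B)
    -- To extend `φ` from `A` to `P`, first pull it back to `G` along the retraction `g`.
    obtain ⟨ψ, hψ⟩ := exists_extension hs' (hGP.subsingleton_ext hG' hB 0) (g ≫ φ)
    refine ⟨ψ, ?_⟩
    dsimp at hψ ⊢
    rw [Category.assoc, hψ, reassoc_of% hσ]

lemma rightOrthogonalOne_GP_le [EnoughProjectives C] (hXY : GPAdmissible.{w} X Y)
    (hproj : X ⊓ Y = isProjective C) (h : glGPD C X Y ≤ n) :
    rightOrthogonalOne.{w} (GP X Y) ≤ fun M : C ↦ HasInjectiveDimensionLE M n := by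
  intro B hB
  obtain ⟨⟨L, G, hL, hG, f, g, zero, hs⟩, -⟩ := exists_approximations hXY hproj h B
  obtain ⟨σ⟩ := exists_splitting hs (hB G hG)
  exact ({ i := f, r := σ.r, retract := σ.f_r } : Retract B L).hasInjectiveDimensionLT (n + 1)

lemma isHereditaryCompleteCotorsionPair_of_glGPD_le [EnoughProjectives C]
    (hXY : GPAdmissible.{w} X Y) (hproj : X ⊓ Y = isProjective C) (h : glGPD C X Y ≤ n) :
    IsHereditaryCompleteCotorsionPair.{w} (GP X Y) (fun M ↦ HasInjectiveDimensionLE M n) := by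
  have hGP := isProjectivelyCoresolved_GP hXY hproj
  refine ⟨⟨?_, ?_⟩, ⟨fun A ↦ ?_, fun A ↦ ?_⟩, ?_⟩
  · exact le_antisymm (rightOrthogonalOne_GP_le hXY hproj h)
      fun B hB A hA ↦ hGP.subsingleton_ext hA hB 0
  · exact le_antisymm (fun A hA B hB ↦ hGP.subsingleton_ext hA hB 0)
      (leftOrthogonalOne_le_GP hXY hproj h)
  · obtain ⟨-, L, G, hL, hG, f, g, zero, hs⟩ := exists_approximations hXY hproj h A
    exact ⟨_, hs, hL, hG, ⟨Iso.refl _⟩⟩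
  · obtain ⟨⟨L, G, hL, hG, f, g, zero, hs⟩, -⟩ := exists_approximations hXY hproj h A
    exact ⟨_, hs, ⟨Iso.refl _⟩, hL, hG⟩
  · intro A B hA hB i hi
    obtain ⟨i, rfl⟩ : ∃ j, i = j + 1 := ⟨i - 1, by lia⟩
    exact hGP.subsingleton_ext hA hB i

/-- Every object has zero Ext^(n+1) into objects of injective dimension at most `n`, and each syzygy
lowers that degree by one; after `n` steps the hypothesis applies. -/
lemma glGPD_le_of_leftOrthogonalOne_le [EnoughProjectives C] (hproj : X ⊓ Y = isProjective C)
    (h : leftOrthogonalOne.{w} (fun M : C ↦ HasInjectiveDimensionLE M n) ≤ GP X Y) :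
    glGPD C X Y ≤ n := by
  refine iSup_le fun M ↦ resdim_le_iff.2 ⟨n, le_rfl, ?_⟩
  refine hasResolution_of_syzygies (R := fun k A ↦ ∀ B, HasInjectiveDimensionLE B n →
    Subsingleton (Ext.{w} A B (k + 1))) h (fun k D hD ↦ ?_) ?_
  · obtain ⟨K, P, hP, hs⟩ := exists_hasShortExact_projective D
    exact ⟨K, P, fun B hB ↦ hs.subsingleton_ext_first B (k + 1)
      (Ext.subsingleton_of_projective P B k) (hD B hB), GP_of_projective.{w} hproj P, hs⟩
  · exact fun B hB ↦ HasInjectiveDimensionLT.subsingleton B (n + 1) (n + 1) le_rfl M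

end Cotorsion

end RelGorenstein

theorem proposition3p14 {C : Type u} [Category.{v} C] [Abelian C] [HasExt.{w} C]
    [EnoughProjectives C] [EnoughInjectives C] (X Y : ObjectProperty C)
    (hXY : RelGorenstein.GPAdmissible.{w} X Y) (hproj : X ⊓ Y = isProjective C) (n : ℕ) :
    RelGorenstein.glGPD C X Y ≤ (n : ℕ∞) ↔
      RelGorenstein.IsHereditaryCompleteCotorsionPair.{w} (RelGorenstein.GP X Y)
        (RelGorenstein.coresdimLE (isInjective C) n) := by
  rw [RelGorenstein.coresdimLE_isInjective]
  exact ⟨RelGorenstein.isHereditaryCompleteCotorsionPair_of_glGPD_le hXY hproj,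
    fun h ↦ RelGorenstein.glGPD_le_of_leftOrthogonalOne_le hproj h.cotorsion.left_eq.ge⟩
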